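/- Let $r\geq 1$ and let $C_1,\ldots,C_r$ be cyclic $2$-groups generated by $x_1,\ldots,x_r$ respectively, where $2^{\alpha_i}$ is the order of $x_i$, and assume that $1\leq\alpha_1\leq\alpha_2\leq\cdots\leq\alpha_r$. Let $G$ be the $2$-nilpotent product of $C_1,\ldots,C_r$, that is, $G=F/F_3$, where $F=C_1*\cdots*C_r$ is the free product and $F_1=F$, $F_{n+1}=[F_n,F]$ is its lower central series. Then $G$ is capable, i.e. there exists a group $H$ with $G\cong H/Z(H)$, if and only if $r>1$ and $\alpha_r\leq\alpha_{r-1}+1$. -/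

import Mathlib

/-- The `k`-nilpotent product of a family of groups `A i`: the quotient `F / F_{k+1}` of their
free product `F` by the `(k+1)`-st term of the lower central series of `F`, where `F_1 = F` and
`F_{n+1} = [F_n, F]`.  Mathlib numbers the lower central series from `0`
(term `0` is the whole group), so `F_{k+1}` is term number `k`. -/
abbrev NilpotentProduct (k : ℕ) {ι : Type*} (A : ι → Type*) [∀ i, Group (A i)] :=
  Monoid.CoprodI A ⧸ (⊤ : Subgroup (Monoid.CoprodI A)).lowerCentralSeries k

/-- A group `G` is capable if there is a group `H` with `G ≅ H / Z(H)`.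
Taking `H` in the universe of `G` loses nothing: if `G ≅ H / Z(H)` with `H` in any universe,
and `H₀` is the subgroup generated by a set of coset representatives of `Z(H)` in `H`,
then `H = H₀ Z(H)`, hence `Z(H₀) = H₀ ∩ Z(H)` and `H₀ / Z(H₀) ≅ G`, while the cardinality of `H₀`
is at most the maximum of that of `G` and `ℵ₀`. -/
def IsCapable.{u} (G : Type u) [Group G] : Prop :=
  ∃ (H : Type u) (_ : Group H), Nonempty (G ≃* H ⧸ Subgroup.center H)

/-!
Capability of the 2-nilpotent product `G` of cyclic 2-groups, with generators `x i` of order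
`2 ^ α i` in increasing order.

Necessity.  Let `G ≅ H / Z(H)`, so that `H` has class at most three, and let `y i` lift `x i`.  If
`n` kills all generators of `G` but the last, then the powers `y i ^ n` are central for those `i`,
and a commutator calculation (`commute_pow_two_mul_of_pow_mem_center`) shows that the power
`2 * n` of the last lift commutes with every lift, hence is central; so the last generator has order
dividing `2 * n`.  The factor `2` is there because `n choose 2` is not divisible by an even `n`.  For
a single factor the lift itself is central, and `G` would be trivial.

Sufficiency.  A group in which every nontrivial element survives in some quotient of the form
`T / Z(T)` is capable: take a fibre product (`isCapable_of_forall_ne_one`).  By the universal property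
of `G`, such a quotient arises from elements `z i` of a group of class three, provided that each
`z i ^ 2 ^ α i` commutes with all the `z j` (`NilpotentProduct.exists_hom_quotient_center`).  All the
groups `T` needed are generated by two unitriangular `4 × 4` matrices over `ZMod (2 * n)`, placed at
two indices, with all other `z l` trivial:

* `skewRotation` and `rotation` have central `n`-th powers when `n` is even.  They detect the
  exponent modulo `n` of the generator at the first index, and the exponent modulo `n` of the
  commutator of the two generators.
* `translation` and `rotation` have central powers of exponents `2 * n` and `n`.  They detect the
  exponent modulo `2 * n` of a power of the generator at the first index, which settles the case in
  which the largest order is twice the second largest.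

An element of `G` is determined by its image in the abelianization and, up to that, by the
exponents of the commutators `⁅x i, x j⁆` with `i < j`, so these homomorphisms together detect every
nontrivial element (`IsUndetectable.eq_one`).
-/

open scoped commutatorElement IsMulCommutative

/-! ### Groups of class two and central quotients -/

theorem commutatorElement_commutatorElement_eq_one_of_lowerCentralSeries {G : Type*} [Group G]
    (h : (⊤ : Subgroup G).lowerCentralSeries 2 = ⊥) (a b c : G) : ⁅⁅a, b⁆, c⁆ = 1 := by
  rw [← Subgroup.mem_bot, ← h]
  exact Subgroup.commutator_mem_commutator
    (Subgroup.commutator_mem_commutator (Subgroup.mem_top a) (Subgroup.mem_top b))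
    (Subgroup.mem_top c)

theorem lowerCentralSeries_two_eq_bot_iff {G : Type*} [Group G] :
    (⊤ : Subgroup G).lowerCentralSeries 2 = ⊥ ↔ ∀ a b c : G, ⁅⁅a, b⁆, c⁆ = 1 := by
  refine ⟨commutatorElement_commutatorElement_eq_one_of_lowerCentralSeries, fun h => ?_⟩
  have hc : (⊤ : Subgroup G).lowerCentralSeries 1 ≤ Subgroup.center G := by
    refine Subgroup.commutator_le.2 fun a _ b _ => Subgroup.mem_center_iff.2 fun c => ?_
    exact (commutatorElement_eq_one_iff_mul_comm.1 (h a b c)).symm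
  rw [eq_bot_iff]
  refine Subgroup.commutator_le.2 fun a ha b _ => ?_
  rw [Subgroup.mem_bot, commutatorElement_eq_one_iff_mul_comm]
  exact (Subgroup.mem_center_iff.1 (hc ha) b).symm

theorem mem_center_of_closure_eq_top {G : Type*} [Group G] {s : Set G}
    (hs : Subgroup.closure s = ⊤) {g : G} (hg : ∀ x ∈ s, Commute g x) :
    g ∈ Subgroup.center G := by
  have h : Subgroup.closure s ≤ Subgroup.centralizer {g} := by
    rw [Subgroup.closure_le]
    intro x hx
    rw [SetLike.mem_coe, Subgroup.mem_centralizer_singleton_iff]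
    exact (hg x hx).symm
  rw [hs] at h
  refine Subgroup.mem_center_iff.2 fun x => ?_
  exact Subgroup.mem_centralizer_singleton_iff.1 (h (Subgroup.mem_top x))

/-- If `π : H → G` is onto with central kernel, then `H` is generated by the kernel and by lifts of
generators of `G`, so commuting with those lifts suffices for being central. -/
theorem mem_center_of_commute_lifts {H G ι : Type*} [Group H] [Group G] (π : H →* G)
    (hker : π.ker ≤ Subgroup.center H) {y : ι → H}
    (hy : Subgroup.closure (Set.range fun i => π (y i)) = ⊤) {g : H}
    (hg : ∀ i, Commute g (y i)) : g ∈ Subgroup.center H := by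
  have hle : Subgroup.closure (Set.range y) ≤ Subgroup.centralizer {g} := by
    rw [Subgroup.closure_le]
    rintro _ ⟨i, rfl⟩
    rw [SetLike.mem_coe, Subgroup.mem_centralizer_singleton_iff]
    exact (hg i).symm
  refine Subgroup.mem_center_iff.2 fun h => ?_
  have hmem : π h ∈ (Subgroup.closure (Set.range y)).map π := by
    rw [MonoidHom.map_closure, ← Set.range_comp]
    exact hy ▸ Subgroup.mem_top _
  obtain ⟨w, hw, hwh⟩ := hmem
  have hz : w⁻¹ * h ∈ Subgroup.center H := hker (by simp [MonoidHom.mem_ker, hwh])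
  have h1 : w * g = g * w := Subgroup.mem_centralizer_singleton_iff.1 (hle hw)
  have h2 : g * (w⁻¹ * h) = (w⁻¹ * h) * g := Subgroup.mem_center_iff.1 hz g
  calc h * g = w * ((w⁻¹ * h) * g) := by group
    _ = (w * g) * (w⁻¹ * h) := by rw [← h2]; group
    _ = g * h := by rw [h1]; group

theorem exists_prod_zpow_of_mem_closure_range {ι A : Type*} [Fintype ι] [CommGroup A] {x : ι → A}
    {a : A} (ha : a ∈ Subgroup.closure (Set.range x)) : ∃ e : ι → ℤ, a = ∏ i, x i ^ e i := by
  classical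
  induction ha using Subgroup.closure_induction with
  | mem _ h =>
    obtain ⟨i, rfl⟩ := h
    refine ⟨Pi.single i 1, ?_⟩
    rw [Finset.prod_eq_single i] <;> simp +contextual
  | one => exact ⟨0, by simp⟩
  | mul _ _ _ _ h₁ h₂ =>
    obtain ⟨e₁, rfl⟩ := h₁
    obtain ⟨e₂, rfl⟩ := h₂
    exact ⟨e₁ + e₂, by simp [zpow_add, Finset.prod_mul_distrib]⟩
  | inv _ _ h =>
    obtain ⟨e, rfl⟩ := h
    exact ⟨-e, by simp⟩

/-! ### The universal property of the 2-nilpotent product of cyclic groups -/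

section NilpotentProduct

variable {ι : Type*} {C : ι → Type*} [∀ i, Group (C i)]

/-- The canonical homomorphism from a factor to the `k`-nilpotent product. -/
def NilpotentProduct.of (k : ℕ) (i : ι) : C i →* NilpotentProduct k C :=
  (QuotientGroup.mk' _).comp Monoid.CoprodI.of

theorem NilpotentProduct.closure_range_of_gen (k : ℕ) {x : ∀ i, C i}
    (hx : ∀ i, Subgroup.zpowers (x i) = ⊤) :
    Subgroup.closure (Set.range fun i => NilpotentProduct.of k i (x i)) = ⊤ := by
  set S := Subgroup.closure (Set.range fun i => NilpotentProduct.of k i (x i))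
  rw [eq_top_iff]
  rintro g -
  obtain ⟨w, rfl⟩ := QuotientGroup.mk'_surjective _ g
  induction w using Monoid.CoprodI.induction_on with
  | one => exact S.one_mem
  | of i c =>
    obtain ⟨n, rfl⟩ := Subgroup.mem_zpowers_iff.1 (hx i ▸ Subgroup.mem_top c)
    have h : NilpotentProduct.of k i (x i) ∈ S := Subgroup.subset_closure ⟨i, rfl⟩
    simpa [NilpotentProduct.of] using S.zpow_mem h n
  | mul a b ha hb => simpa using S.mul_mem ha hb

theorem NilpotentProduct.lowerCentralSeries_eq_bot (k : ℕ) :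
    (⊤ : Subgroup (NilpotentProduct k C)).lowerCentralSeries k = ⊥ := by
  rw [← Subgroup.map_top_of_surjective _ (QuotientGroup.mk'_surjective
    ((⊤ : Subgroup (Monoid.CoprodI C)).lowerCentralSeries k)), ← Subgroup.map_lowerCentralSeries,
    QuotientGroup.map_mk'_self]

theorem NilpotentProduct.exists_hom {x : ∀ i, C i} (hx : ∀ i, Subgroup.zpowers (x i) = ⊤)
    {Q : Type*} [Group Q] (hQ : ∀ a b c : Q, ⁅⁅a, b⁆, c⁆ = 1) (y : ι → Q)
    (hy : ∀ i, y i ^ orderOf (x i) = 1) :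
    ∃ φ : NilpotentProduct 2 C →* Q, ∀ i, φ (NilpotentProduct.of 2 i (x i)) = y i := by
  have hg : ∀ i (c : C i), c ∈ Subgroup.zpowers (x i) := fun i c => hx i ▸ Subgroup.mem_top c
  let f : Monoid.CoprodI C →* Q := Monoid.CoprodI.lift fun i =>
    monoidHomOfForallMemZpowers (hg i) (orderOf_dvd_of_pow_eq_one (hy i))
  have hf : (⊤ : Subgroup (Monoid.CoprodI C)).lowerCentralSeries 2 ≤ f.ker := by
    rw [← MonoidHom.comap_bot, ← Subgroup.map_le_iff_le_comap]
    rw [Subgroup.map_lowerCentralSeries, ← lowerCentralSeries_two_eq_bot_iff.2 hQ]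
    exact Subgroup.lowerCentralSeries_mono 2 le_top
  refine ⟨QuotientGroup.lift _ f hf, fun i => ?_⟩
  change f (Monoid.CoprodI.of (x i)) = y i
  simp [f]

theorem NilpotentProduct.orderOf_of {x : ∀ i, C i} (hx : ∀ i, Subgroup.zpowers (x i) = ⊤) (i : ι) :
    orderOf (NilpotentProduct.of 2 i (x i)) = orderOf (x i) := by
  classical
  refine Nat.dvd_antisymm (orderOf_map_dvd _ _) ?_
  have hcomm : ∀ a b : C i, a * b = b * a := by
    intro a b
    obtain ⟨m, rfl⟩ := Subgroup.mem_zpowers_iff.1 (hx i ▸ Subgroup.mem_top a)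
    obtain ⟨n, rfl⟩ := Subgroup.mem_zpowers_iff.1 (hx i ▸ Subgroup.mem_top b)
    exact zpow_mul_comm _ _ _
  obtain ⟨φ, hφ⟩ := NilpotentProduct.exists_hom hx (Q := C i)
    (fun a b c => commutatorElement_eq_one_iff_mul_comm.2 (hcomm _ _)) (Pi.mulSingle i (x i)) <| by
      intro j
      by_cases h : j = i
      · subst h; simp [pow_orderOf_eq_one]
      · simp [h]
  have := orderOf_map_dvd φ (NilpotentProduct.of 2 i (x i))
  rwa [hφ, Pi.mulSingle_eq_same] at this

end NilpotentProduct

/-! ### Necessity: commutators with powers in class three -/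

/-- In a group of class at most three, if `x ^ n` is central then `x` commutes with `y ^ (2 * n)`.
With `c = ⁅x, y⁆`, `d = ⁅x, c⁆` and `e = ⁅y, c⁆`, conjugating `y` by `x ^ n` gives
`d ^ (n choose 2) * c ^ n = 1`, conjugating `c` gives `d ^ n = 1`; hence `e ^ n = 1` and
`c ^ (2 * n) = 1`, while `⁅x, y ^ m⁆ = e ^ (m choose 2) * c ^ m`. -/
theorem commute_pow_two_mul_of_pow_mem_center {H : Type*} [Group H]
    (hH : ∀ a b c : H, ⁅⁅a, b⁆, c⁆ ∈ Subgroup.center H) {x y : H} {n : ℕ}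
    (hx : x ^ n ∈ Subgroup.center H) : Commute (y ^ (2 * n)) x := by
  obtain ⟨c, hc⟩ : ∃ c, c = ⁅x, y⁆ := ⟨_, rfl⟩
  have hcen : ∀ z, ⁅z, c⁆ ∈ Subgroup.center H := fun z => by
    rw [hc, ← commutatorElement_inv]; exact Subgroup.inv_mem _ (hH _ _ _)
  obtain ⟨d, hd⟩ : ∃ d, d = ⁅x, c⁆ := ⟨_, rfl⟩
  obtain ⟨e, he⟩ : ∃ e, e = ⁅y, c⁆ := ⟨_, rfl⟩
  have hdc : ∀ z, Commute d z := fun z => (Subgroup.mem_center_iff.1 (hd ▸ hcen x) z).symm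
  have hec : ∀ z, Commute e z := fun z => (Subgroup.mem_center_iff.1 (he ▸ hcen y) z).symm
  have hxc : ∀ z, Commute (x ^ n) z := fun z => (Subgroup.mem_center_iff.1 hx z).symm
  have hxy : x * y = c * y * x := by rw [hc, commutatorElement_def]; group
  have hxcx : x * c = d * c * x := by rw [hd, commutatorElement_def]; group
  have hyc : y * c = e * c * y := by rw [he, commutatorElement_def]; group
  have h1 : ∀ k : ℕ, SemiconjBy x (c ^ k) (d ^ k * c ^ k) := fun k => by
    rw [← (hdc c).mul_pow]
    exact SemiconjBy.pow_right hxcx k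
  have h2 : ∀ k : ℕ, SemiconjBy y (c ^ k) (e ^ k * c ^ k) := fun k => by
    rw [← (hec c).mul_pow]
    exact SemiconjBy.pow_right hyc k
  have h3 : ∀ k : ℕ, SemiconjBy (x ^ k) c (d ^ k * c) := by
    intro k
    induction k with
    | zero => simp [SemiconjBy]
    | succ k ih =>
      rw [pow_succ']
      have := SemiconjBy.mul_left (((hdc x).symm.pow_right k).semiconjBy.mul_right
        (show SemiconjBy x c (d * c) from hxcx)) ih
      rwa [← mul_assoc, ← pow_succ] at this
  have h4 : ∀ k : ℕ, SemiconjBy (x ^ k) y (d ^ k.choose 2 * c ^ k * y) := by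
    intro k
    induction k with
    | zero => simp [SemiconjBy]
    | succ k ih =>
      rw [pow_succ']
      have := SemiconjBy.mul_left ((((hdc x).symm.pow_right (k.choose 2)).semiconjBy.mul_right
        (h1 k)).mul_right (show SemiconjBy x y (c * y) from by rw [SemiconjBy, hxy])) ih
      rw [Nat.choose_succ_succ' k 1, Nat.choose_one_right, add_comm k (k.choose 2), pow_add,
        pow_succ c]
      simpa only [mul_assoc] using this
  have h5 : ∀ k : ℕ, SemiconjBy (y ^ k) c (e ^ k * c) := by
    intro k
    induction k with
    | zero => simp [SemiconjBy]
    | succ k ih =>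
      rw [pow_succ']
      have := SemiconjBy.mul_left (((hec y).symm.pow_right k).semiconjBy.mul_right
        (show SemiconjBy y c (e * c) from hyc)) ih
      rwa [← mul_assoc, ← pow_succ] at this
  have h6 : ∀ k : ℕ, (c * y) ^ k = e ^ k.choose 2 * c ^ k * y ^ k := by
    intro k
    induction k with
    | zero => simp
    | succ k ih =>
      rw [pow_succ, ih, Nat.choose_succ_succ' k 1, Nat.choose_one_right, add_comm k, pow_add,
        pow_succ c, pow_succ y]
      have h5k : y ^ k * c = e ^ k * c * y ^ k := h5 k
      calc e ^ k.choose 2 * c ^ k * y ^ k * (c * y)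
          = e ^ k.choose 2 * c ^ k * (y ^ k * c) * y := by simp only [mul_assoc]
        _ = e ^ k.choose 2 * (c ^ k * e ^ k) * c * y ^ k * y := by
          rw [h5k]; simp only [mul_assoc]
        _ = _ := by rw [((hec (c ^ k)).pow_left k).eq.symm]; simp only [mul_assoc]
  have hdn : d ^ n = 1 := by
    have : x ^ n * c = d ^ n * c * x ^ n := h3 n
    rw [(hxc c).eq, mul_left_inj] at this
    exact right_eq_mul.1 this
  have hcn : d ^ n.choose 2 * c ^ n = 1 := by
    have : x ^ n * y = d ^ n.choose 2 * c ^ n * y * x ^ n := h4 n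
    rw [(hxc y).eq, mul_left_inj] at this
    exact right_eq_mul.1 this
  have hcn' : c ^ n = (d ^ n.choose 2)⁻¹ := (inv_eq_of_mul_eq_one_right hcn).symm
  have hen : e ^ n = 1 := by
    have h : y * c ^ n = e ^ n * c ^ n * y := h2 n
    have h' : y * c ^ n = c ^ n * y := by
      rw [hcn']; exact (((hdc y).pow_left _).inv_left).symm
    rw [h', mul_left_inj] at h
    exact right_eq_mul.1 h
  have hc2n : c ^ (2 * n) = 1 := by
    rw [mul_comm, pow_mul, hcn', inv_pow, ← pow_mul, Nat.choose_two_right,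
      Nat.div_mul_cancel (Nat.even_mul_pred_self n).two_dvd, pow_mul, hdn, one_pow, inv_one]
  have he2n : e ^ (2 * n).choose 2 = 1 := by
    have : (2 * n).choose 2 = n * (2 * n - 1) := by
      rw [Nat.choose_two_right, mul_assoc, Nat.mul_div_cancel_left _ two_pos]
    rw [this, pow_mul, hen, one_pow]
  have h7 : SemiconjBy x (y ^ (2 * n)) ((c * y) ^ (2 * n)) :=
    SemiconjBy.pow_right (show x * y = c * y * x from hxy) _
  rw [h6, hc2n, he2n, one_mul, one_mul] at h7
  exact Commute.symm h7

/-- If `G` is capable and of class at most two, and all generators but `x l` have order dividing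
`n`, then `x l` has order dividing `2 * n`: that power of a lift of `x l` is central. -/
theorem IsCapable.pow_two_mul_eq_one {ι : Type*} {G : Type*} [Group G] (hG : IsCapable G)
    (hG2 : ∀ a b c : G, ⁅⁅a, b⁆, c⁆ = 1) {x : ι → G}
    (hx : Subgroup.closure (Set.range x) = ⊤) {l : ι} {n : ℕ} (hn : ∀ i, i ≠ l → x i ^ n = 1) :
    x l ^ (2 * n) = 1 := by
  obtain ⟨H, _, ⟨ε⟩⟩ := hG
  let π : H →* G := ε.symm.toMonoidHom.comp (QuotientGroup.mk' (Subgroup.center H))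
  have hπ : Function.Surjective π := ε.symm.surjective.comp (QuotientGroup.mk'_surjective _)
  have hker : π.ker = Subgroup.center H := by
    ext h; simp [π]
  choose y hy using fun i => hπ (x i)
  have hH : ∀ a b c : H, ⁅⁅a, b⁆, c⁆ ∈ Subgroup.center H := fun a b c => by
    rw [← hker, MonoidHom.mem_ker, map_commutatorElement, map_commutatorElement, hG2]
  have hmem : y l ^ (2 * n) ∈ Subgroup.center H := by
    refine mem_center_of_commute_lifts π hker.le (y := y) (by simpa [hy] using hx) fun i => ?_
    by_cases hi : i = l
    · subst hi; exact Commute.pow_self _ _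
    · refine commute_pow_two_mul_of_pow_mem_center hH ?_
      rw [← hker, MonoidHom.mem_ker, map_pow, hy, hn i hi]
  rw [← hker, MonoidHom.mem_ker, map_pow, hy] at hmem
  exact hmem

/-- A capable group generated by at most one element is trivial. -/
theorem IsCapable.eq_one_of_subsingleton {ι : Type*} [Subsingleton ι] {G : Type*} [Group G]
    (hG : IsCapable G) {x : ι → G} (hx : Subgroup.closure (Set.range x) = ⊤) (l : ι) :
    x l = 1 := by
  obtain ⟨H, _, ⟨ε⟩⟩ := hG
  let π : H →* G := ε.symm.toMonoidHom.comp (QuotientGroup.mk' (Subgroup.center H))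
  have hπ : Function.Surjective π := ε.symm.surjective.comp (QuotientGroup.mk'_surjective _)
  have hker : π.ker = Subgroup.center H := by
    ext h; simp [π]
  choose y hy using fun i => hπ (x i)
  have hmem : y l ∈ Subgroup.center H :=
    mem_center_of_commute_lifts π hker.le (y := y) (by simpa [hy] using hx) fun i =>
      Subsingleton.elim l i ▸ Commute.refl _
  rwa [← hker, MonoidHom.mem_ker, hy] at hmem

/-! ### Capability is residual -/

/-- A group is capable once each of its nontrivial elements survives in a capable quotient.  If
`φ g : G → T g / Z(T g)` are the quotient maps, the witness is the fibre product of `G` with all the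
`T g`: it maps onto `G`, and onto each `T g`, so a central element has central components, and its
image in `G` lies in the kernel of each `φ g`. -/
theorem isCapable_of_forall_ne_one.{u} {G : Type u} [Group G]
    (h : ∀ g : G, g ≠ 1 → ∃ (T : Type) (_ : Group T) (φ : G →* T ⧸ Subgroup.center T),
      Function.Surjective φ ∧ φ g ≠ 1) : IsCapable G := by
  have h' : ∀ g : {g : G // g ≠ 1}, ∃ (T : Type) (_ : Group T) (φ : G →* T ⧸ Subgroup.center T),
      Function.Surjective φ ∧ φ g ≠ 1 := fun g => h g g.2
  choose T hT φ hφ hne using h'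
  let P : Subgroup (G × ∀ g, T g) :=
    { carrier := {p | ∀ g, φ g p.1 = QuotientGroup.mk' _ (p.2 g)}
      one_mem' := fun g => by simp
      mul_mem' := fun ha hb g => by
        simp only [Prod.fst_mul, Prod.snd_mul, Pi.mul_apply, map_mul, ha g, hb g]
      inv_mem' := fun ha g => by
        simp only [Prod.fst_inv, Prod.snd_inv, Pi.inv_apply, map_inv, ha g] }
  let π : P →* G := (MonoidHom.fst _ _).comp P.subtype
  have hlift : ∀ a : G, ∃ t : ∀ g, T g, ∀ g, φ g a = QuotientGroup.mk' _ (t g) := fun a => by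
    choose t ht using fun g => QuotientGroup.mk'_surjective (Subgroup.center (T g)) (φ g a)
    exact ⟨t, fun g => (ht g).symm⟩
  have hπ : Function.Surjective π := fun a => by
    obtain ⟨t, ht⟩ := hlift a
    exact ⟨⟨(a, t), ht⟩, rfl⟩
  have hker : π.ker = Subgroup.center P := by
    ext p
    rw [MonoidHom.mem_ker, Subgroup.mem_center_iff]
    constructor
    · intro hp q
      have hp1 : p.1.1 = 1 := hp
      refine Subtype.ext (Prod.ext ?_ (funext fun g => ?_))
      · change q.1.1 * p.1.1 = p.1.1 * q.1.1
        rw [hp1, one_mul, mul_one]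
      · have hpg := p.2 g
        rw [hp1, map_one, eq_comm, QuotientGroup.mk'_apply, QuotientGroup.eq_one_iff] at hpg
        exact Subgroup.mem_center_iff.1 hpg _
    · intro hp
      by_contra hne1
      let g : {g : G // g ≠ 1} := ⟨π p, hne1⟩
      refine hne g ?_
      have hpg : φ g (π p) = QuotientGroup.mk' _ (p.1.2 g) := p.2 g
      change φ g (π p) = 1
      rw [hpg, QuotientGroup.mk'_apply, QuotientGroup.eq_one_iff, Subgroup.mem_center_iff]
      intro s
      classical
      obtain ⟨a, ha⟩ := hφ g (QuotientGroup.mk' _ s)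
      obtain ⟨t, ht⟩ := hlift a
      -- The lift of `a` is adjusted to have component `s` at `g`.
      let q : P := ⟨(a, Function.update t g s), fun k => by
        by_cases hk : k = g
        · subst hk; simpa using ha
        · simpa [Function.update_of_ne hk] using ht k⟩
      have := congrArg (fun r : P => r.1.2 g) (hp q)
      simpa [q] using this
  exact ⟨P, inferInstance, ⟨((QuotientGroup.quotientMulEquivOfEq hker.symm).trans
    (QuotientGroup.quotientKerEquivOfSurjective π hπ)).symm⟩⟩

/-! ### Coordinates in groups of class two -/

theorem commutatorElement_pow_eq_one {G : Type*} [Group G] (hG : ∀ a b c : G, ⁅⁅a, b⁆, c⁆ = 1)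
    {a b : G} {n : ℕ} (ha : a ^ n = 1) : ⁅a, b⁆ ^ n = 1 := by
  have hc : ∀ z, Commute ⁅a, b⁆ z := fun z => commutatorElement_eq_one_iff_commute.1 (hG a b z)
  have h : ∀ k : ℕ, SemiconjBy (a ^ k) b (⁅a, b⁆ ^ k * b) := by
    intro k
    induction k with
    | zero => simp [SemiconjBy]
    | succ k ih =>
      have hab : SemiconjBy a b (⁅a, b⁆ * b) := by
        rw [SemiconjBy, commutatorElement_def]; group
      rw [pow_succ', pow_succ, mul_assoc]
      exact SemiconjBy.mul_left (((hc a).symm.pow_right k).semiconjBy.mul_right hab) ih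
  have := h n
  rw [ha, SemiconjBy, one_mul, mul_one] at this
  exact right_eq_mul.1 this

theorem exists_abelianization_of_eq_prod {ι G : Type*} [Fintype ι] [Group G] {x : ι → G}
    (hx : Subgroup.closure (Set.range x) = ⊤) (g : G) :
    ∃ e : ι → ℤ, Abelianization.of g = ∏ i, Abelianization.of (x i) ^ e i := by
  refine exists_prod_zpow_of_mem_closure_range (x := fun i => Abelianization.of (x i)) ?_
  have h : Subgroup.closure (Set.range fun i => Abelianization.of (x i)) =
      (Subgroup.closure (Set.range x)).map Abelianization.of := by
    rw [MonoidHom.map_closure, ← Set.range_comp]; rfl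
  rw [h, hx]
  exact Subgroup.mem_map_of_mem _ (Subgroup.mem_top g)

/-- The commutator `⁅x i, x j⁆`, `i < j`, in a group of class at most two, as an element of the
centre.  Working in the centre makes the products of such commutators independent of the order of
the factors. -/
def centralCommutator {ι G : Type*} [LT ι] [Group G] (hG : ∀ a b c : G, ⁅⁅a, b⁆, c⁆ = 1)
    (x : ι → G) (p : {p : ι × ι // p.1 < p.2}) : Subgroup.center G :=
  ⟨⁅x p.1.1, x p.1.2⁆, Subgroup.mem_center_iff.2 fun c =>
    (commutatorElement_eq_one_iff_mul_comm.1 (hG _ _ c)).symm⟩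

theorem exists_eq_prod_centralCommutator {ι G : Type*} [LinearOrder ι] [Fintype ι] [Group G]
    (hG : ∀ a b c : G, ⁅⁅a, b⁆, c⁆ = 1) {x : ι → G}
    (hx : Subgroup.closure (Set.range x) = ⊤) {g : G} (hg : g ∈ commutator G) :
    ∃ f : {p : ι × ι // p.1 < p.2} → ℤ,
      g = ((∏ p, centralCommutator hG x p ^ f p : Subgroup.center G) : G) := by
  let S : Subgroup (Subgroup.center G) := Subgroup.closure (Set.range (centralCommutator hG x))
  let K : Subgroup G := S.map (Subgroup.center G).subtype
  have hK : K ≤ Subgroup.center G := Subgroup.map_subtype_le S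
  have hKn : K.Normal := ⟨fun k hk a => by
    rw [Subgroup.mem_center_iff.1 (hK hk) a, mul_inv_cancel_right]; exact hk⟩
  have hlt : ∀ i j, i < j → Commute (QuotientGroup.mk' K (x i)) (QuotientGroup.mk' K (x j)) := by
    intro i j hij
    rw [← commutatorElement_eq_one_iff_commute, ← map_commutatorElement, QuotientGroup.mk'_apply,
      QuotientGroup.eq_one_iff]
    exact ⟨centralCommutator hG x ⟨(i, j), hij⟩, Subgroup.subset_closure ⟨_, rfl⟩, rfl⟩
  have hcl : Subgroup.closure (Set.range fun i => QuotientGroup.mk' K (x i)) = ⊤ := by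
    have h : Subgroup.closure (Set.range fun i => QuotientGroup.mk' K (x i)) =
        (Subgroup.closure (Set.range x)).map (QuotientGroup.mk' K) := by
      rw [MonoidHom.map_closure, ← Set.range_comp]; rfl
    rw [h, hx, Subgroup.map_top_of_surjective _ (QuotientGroup.mk'_surjective K)]
  have hgen : ∀ i, QuotientGroup.mk' K (x i) ∈ Subgroup.center (G ⧸ K) := by
    intro i
    refine mem_center_of_closure_eq_top hcl ?_
    rintro _ ⟨j, rfl⟩
    rcases lt_trichotomy i j with h | h | h
    · exact hlt i j h
    · exact h ▸ Commute.refl _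
    · exact (hlt j i h).symm
  have htop : Subgroup.center (G ⧸ K) = ⊤ := by
    rw [eq_top_iff, ← hcl, Subgroup.closure_le]
    rintro _ ⟨i, rfl⟩
    exact hgen i
  have hle : commutator G ≤ K := by
    refine Subgroup.commutator_le.2 fun a _ b _ => ?_
    rw [← QuotientGroup.eq_one_iff, ← QuotientGroup.mk'_apply, map_commutatorElement,
      commutatorElement_eq_one_iff_mul_comm]
    exact Subgroup.mem_center_iff.1 (htop ▸ Subgroup.mem_top (QuotientGroup.mk' K b)) _
  obtain ⟨s, hs, rfl⟩ := hle hg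
  obtain ⟨f, rfl⟩ := exists_prod_zpow_of_mem_closure_range hs
  exact ⟨f, rfl⟩

/-! ### The unitriangular group of degree four -/

/-- Upper unitriangular `4 × 4` matrices over `R`: `a`, `b`, `c` are the entries above the diagonal,
`d`, `e` those on the next diagonal, and `f` is the corner. -/
@[ext]
structure UnitriangularFour (R : Type*) where
  a : R
  b : R
  c : R
  d : R
  e : R
  f : R

namespace UnitriangularFour

variable {R : Type*} [CommRing R]

instance : Mul (UnitriangularFour R) :=
  ⟨fun g h => ⟨g.a + h.a, g.b + h.b, g.c + h.c, g.d + h.d + g.a * h.b, g.e + h.e + g.b * h.c,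
    g.f + h.f + g.a * h.e + g.d * h.c⟩⟩

instance : One (UnitriangularFour R) := ⟨⟨0, 0, 0, 0, 0, 0⟩⟩

instance : Inv (UnitriangularFour R) :=
  ⟨fun g => ⟨-g.a, -g.b, -g.c, -g.d + g.a * g.b, -g.e + g.b * g.c,
    -g.f + g.a * g.e + g.d * g.c - g.a * g.b * g.c⟩⟩

@[simp] theorem mul_a (g h : UnitriangularFour R) : (g * h).a = g.a + h.a := rfl
@[simp] theorem mul_b (g h : UnitriangularFour R) : (g * h).b = g.b + h.b := rfl
@[simp] theorem mul_c (g h : UnitriangularFour R) : (g * h).c = g.c + h.c := rfl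
@[simp] theorem mul_d (g h : UnitriangularFour R) : (g * h).d = g.d + h.d + g.a * h.b := rfl
@[simp] theorem mul_e (g h : UnitriangularFour R) : (g * h).e = g.e + h.e + g.b * h.c := rfl
@[simp] theorem mul_f (g h : UnitriangularFour R) :
    (g * h).f = g.f + h.f + g.a * h.e + g.d * h.c := rfl
@[simp] theorem one_a : (1 : UnitriangularFour R).a = 0 := rfl
@[simp] theorem one_b : (1 : UnitriangularFour R).b = 0 := rfl
@[simp] theorem one_c : (1 : UnitriangularFour R).c = 0 := rfl
@[simp] theorem one_d : (1 : UnitriangularFour R).d = 0 := rfl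
@[simp] theorem one_e : (1 : UnitriangularFour R).e = 0 := rfl
@[simp] theorem one_f : (1 : UnitriangularFour R).f = 0 := rfl
@[simp] theorem inv_a (g : UnitriangularFour R) : g⁻¹.a = -g.a := rfl
@[simp] theorem inv_b (g : UnitriangularFour R) : g⁻¹.b = -g.b := rfl
@[simp] theorem inv_c (g : UnitriangularFour R) : g⁻¹.c = -g.c := rfl
@[simp] theorem inv_d (g : UnitriangularFour R) : g⁻¹.d = -g.d + g.a * g.b := rfl
@[simp] theorem inv_e (g : UnitriangularFour R) : g⁻¹.e = -g.e + g.b * g.c := rfl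
@[simp] theorem inv_f (g : UnitriangularFour R) :
    g⁻¹.f = -g.f + g.a * g.e + g.d * g.c - g.a * g.b * g.c := rfl

instance : Group (UnitriangularFour R) :=
  Group.ofLeftAxioms (fun _ _ _ => by ext <;> simp <;> ring) (fun _ => by ext <;> simp)
    (fun _ => by
      ext <;> simp
      ring)

theorem commute_iff {g h : UnitriangularFour R} : Commute g h ↔
    g.a * h.b = h.a * g.b ∧ g.b * h.c = h.b * g.c ∧
      g.a * h.e + g.d * h.c = h.a * g.e + h.d * g.c := by
  rw [commute_iff_eq, UnitriangularFour.ext_iff]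
  simp only [mul_a, mul_b, mul_c, mul_d, mul_e, mul_f]
  constructor
  · rintro ⟨-, -, -, hd, he, hf⟩
    exact ⟨by linear_combination hd, by linear_combination he, by linear_combination hf⟩
  · rintro ⟨hd, he, hf⟩
    exact ⟨add_comm _ _, add_comm _ _, add_comm _ _, by linear_combination hd,
      by linear_combination he, by linear_combination hf⟩

theorem commutator_commutator_mem_center (g h k : UnitriangularFour R) :
    ⁅⁅g, h⁆, k⁆ ∈ Subgroup.center (UnitriangularFour R) := by
  refine Subgroup.mem_center_iff.2 fun x => (commute_iff.2 ?_).symm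
  simp only [commutatorElement_def, mul_a, mul_b, mul_c, mul_d, mul_e, inv_a, inv_b, inv_c, inv_d,
    inv_e]
  refine ⟨?_, ?_, ?_⟩ <;> ring

theorem pow_a (g : UnitriangularFour R) (m : ℕ) : (g ^ m).a = m * g.a := by
  induction m with
  | zero => simp
  | succ m ih => rw [pow_succ, mul_a, ih]; push_cast; ring

theorem pow_b (g : UnitriangularFour R) (m : ℕ) : (g ^ m).b = m * g.b := by
  induction m with
  | zero => simp
  | succ m ih => rw [pow_succ, mul_b, ih]; push_cast; ring

theorem pow_c (g : UnitriangularFour R) (m : ℕ) : (g ^ m).c = m * g.c := by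
  induction m with
  | zero => simp
  | succ m ih => rw [pow_succ, mul_c, ih]; push_cast; ring

theorem pow_d (g : UnitriangularFour R) (m : ℕ) :
    (g ^ m).d = m * g.d + m.choose 2 * (g.a * g.b) := by
  induction m with
  | zero => simp
  | succ m ih =>
    rw [pow_succ, mul_d, ih, pow_a, Nat.choose_succ_succ' m 1, Nat.choose_one_right]
    push_cast; ring

theorem pow_e (g : UnitriangularFour R) (m : ℕ) :
    (g ^ m).e = m * g.e + m.choose 2 * (g.b * g.c) := by
  induction m with
  | zero => simp
  | succ m ih =>
    rw [pow_succ, mul_e, ih, pow_b, Nat.choose_succ_succ' m 1, Nat.choose_one_right]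
    push_cast; ring

theorem zpow_e_of_b_eq_zero {g : UnitriangularFour R} (hg : g.b = 0) (k : ℤ) :
    (g ^ k).e = k * g.e := by
  obtain ⟨m, rfl | rfl⟩ := k.eq_nat_or_neg
  · rw [zpow_natCast, pow_e, hg]; push_cast; ring
  · rw [zpow_neg, zpow_natCast, inv_e, pow_e, pow_b, hg]; push_cast; ring

/-- The entry `c` as a homomorphism to the additive group of `R`. -/
def cHom (R : Type*) [CommRing R] : UnitriangularFour R →* Multiplicative R where
  toFun g := Multiplicative.ofAdd g.c
  map_one' := rfl
  map_mul' _ _ := rfl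

/-- The block-diagonal matrix of a unipotent Jordan block of size three and `1`.  It acts by
conjugation on the translations, the matrices whose only nonzero off-diagonal entries are those of
the last column `(f, e, c)`. -/
def rotation (R : Type*) [CommRing R] : UnitriangularFour R := ⟨1, 1, 0, 0, 0, 0⟩

/-- The translation by `(0, 1, 2)`.  For this choice of column, the condition that the `n`-th power
of `rotation` commute with it is `n + 2 * (n choose 2) = 0`, true in `ZMod (2 * n)` for even `n`. -/
def translation (R : Type*) [CommRing R] : UnitriangularFour R := ⟨0, 0, 2, 0, 1, 0⟩

/-- The product of `translation` and `rotation`. -/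
def skewRotation (R : Type*) [CommRing R] : UnitriangularFour R := ⟨1, 1, 2, 0, 1, 0⟩

theorem commutatorElement_skewRotation_rotation :
    ⁅skewRotation R, rotation R⁆ = ⟨0, 0, 0, 0, -2, -1⟩ := by
  ext <;> simp [commutatorElement_def, skewRotation, rotation] <;> ring

section ZMod

variable {n : ℕ}

theorem two_mul_natCast_eq_zero (n : ℕ) : (n : ZMod (2 * n)) * 2 = 0 := by
  have := ZMod.natCast_self (2 * n)
  push_cast at this
  linear_combination this

/-- For even `n` the sum is `n ^ 2`. -/
theorem natCast_add_choose_two_mul_two (hn : Even n) :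
    (n : ZMod (2 * n)) + n.choose 2 * 2 = 0 := by
  have h : n + n.choose 2 * 2 = n * n := by
    rw [Nat.choose_two_right, Nat.div_mul_cancel (Nat.even_mul_pred_self n).two_dvd]
    cases n with
    | zero => rfl
    | succ m => simp; ring
  have h' : ((n + n.choose 2 * 2 : ℕ) : ZMod (2 * n)) = 0 := by
    rw [h, ZMod.natCast_eq_zero_iff]
    exact Nat.mul_dvd_mul_right hn.two_dvd n
  exact_mod_cast h'

theorem commute_rotation_pow_skewRotation (hn : Even n) :
    Commute (rotation (ZMod (2 * n)) ^ n) (skewRotation (ZMod (2 * n))) := by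
  have h₁ := two_mul_natCast_eq_zero n
  have h₂ := natCast_add_choose_two_mul_two hn
  rw [commute_iff, pow_a, pow_b, pow_c, pow_d, pow_e]
  refine ⟨?_, ?_, ?_⟩ <;> simp [rotation, skewRotation, h₁, h₂]

theorem commute_skewRotation_pow_rotation (hn : Even n) :
    Commute (skewRotation (ZMod (2 * n)) ^ n) (rotation (ZMod (2 * n))) := by
  have h₁ := two_mul_natCast_eq_zero n
  have h₂ := natCast_add_choose_two_mul_two hn
  rw [commute_iff, pow_a, pow_b, pow_c, pow_d, pow_e]
  refine ⟨?_, ?_, ?_⟩ <;> simp [rotation, skewRotation, h₁, h₂]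

theorem commute_rotation_pow_translation (hn : Even n) :
    Commute (rotation (ZMod (2 * n)) ^ n) (translation (ZMod (2 * n))) := by
  have h₁ := two_mul_natCast_eq_zero n
  have h₂ := natCast_add_choose_two_mul_two hn
  rw [commute_iff, pow_a, pow_b, pow_c, pow_d, pow_e]
  refine ⟨?_, ?_, ?_⟩ <;> simp [rotation, translation, h₁, h₂]

theorem commute_translation_pow_rotation :
    Commute (translation (ZMod (2 * n)) ^ (2 * n)) (rotation (ZMod (2 * n))) := by
  have h₁ := ZMod.natCast_self (2 * n)
  rw [commute_iff, pow_a, pow_b, pow_c, pow_d, pow_e, h₁]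
  refine ⟨?_, ?_, ?_⟩ <;> simp [rotation, translation]

theorem dvd_of_intCast_mul_two_eq_zero {k : ℤ} (h : (k : ZMod (2 * n)) * 2 = 0) : (n : ℤ) ∣ k := by
  have h' : ((k * 2 : ℤ) : ZMod (2 * n)) = 0 := by push_cast; exact h
  rw [ZMod.intCast_zmod_eq_zero_iff_dvd] at h'
  push_cast at h'
  rw [mul_comm] at h'
  exact Int.dvd_of_mul_dvd_mul_right two_ne_zero h'

theorem dvd_of_commute_commutator_zpow {k : ℤ}
    (h : Commute (⁅skewRotation (ZMod (2 * n)), rotation (ZMod (2 * n))⁆ ^ k)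
      (rotation (ZMod (2 * n)))) : (n : ℤ) ∣ k := by
  apply dvd_of_intCast_mul_two_eq_zero
  have h₃ := (commute_iff.1 h).2.2
  rw [commutatorElement_skewRotation_rotation] at h₃
  rw [zpow_e_of_b_eq_zero rfl] at h₃
  simpa [rotation] using h₃

theorem dvd_of_commute_translation_zpow {k : ℤ}
    (h : Commute (translation (ZMod (2 * n)) ^ k) (rotation (ZMod (2 * n)))) :
    ((2 * n : ℕ) : ℤ) ∣ k := by
  have h₃ := (commute_iff.1 h).2.2
  rw [zpow_e_of_b_eq_zero rfl] at h₃
  simp only [rotation, translation, mul_one, zero_mul, mul_zero, add_zero, one_mul] at h₃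
  rw [← ZMod.intCast_zmod_eq_zero_iff_dvd]
  simpa [eq_comm] using h₃

theorem c_eq_zero_of_commute_rotation {g : UnitriangularFour R} (h : Commute g (rotation R)) :
    g.c = 0 := by
  have h₂ := (commute_iff.1 h).2.1
  simpa [rotation, eq_comm] using h₂

end ZMod

end UnitriangularFour

/-! ### Detecting elements of the 2-nilpotent product -/

/-- Elements `z i` of a group of class at most three such that each `z i ^ orderOf (x i)` commutes
with all of them generate a subgroup `T` for which `x i ↦ z i` defines a homomorphism onto
`T / Z(T)`. -/
theorem NilpotentProduct.exists_hom_quotient_center {ι : Type*} {C : ι → Type*}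
    [∀ i, Group (C i)] {x : ∀ i, C i} (hx : ∀ i, Subgroup.zpowers (x i) = ⊤) {M : Type*} [Group M]
    (hM : ∀ a b c : M, ⁅⁅a, b⁆, c⁆ ∈ Subgroup.center M) (z : ι → M)
    (hz : ∀ i j, Commute (z i ^ orderOf (x i)) (z j)) :
    ∃ φ : NilpotentProduct 2 C →* Subgroup.closure (Set.range z) ⧸
        Subgroup.center (Subgroup.closure (Set.range z)),
      Function.Surjective φ ∧ ∀ i, φ (NilpotentProduct.of 2 i (x i)) =
        QuotientGroup.mk' _ ⟨z i, Subgroup.subset_closure ⟨i, rfl⟩⟩ := by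
  set T := Subgroup.closure (Set.range z) with hT
  let y : ι → T := fun i => ⟨z i, Subgroup.subset_closure ⟨i, rfl⟩⟩
  have hy : Subgroup.closure (Set.range y) = ⊤ := by
    have h := Subgroup.closure_closure_coe_preimage (k := Set.range z)
    convert h using 2
    ext t
    constructor
    · rintro ⟨i, rfl⟩; exact ⟨i, rfl⟩
    · rintro ⟨i, hi⟩; exact ⟨i, Subtype.ext hi⟩
  obtain ⟨φ, hφ⟩ := NilpotentProduct.exists_hom hx (Q := T ⧸ Subgroup.center T) (by
      intro a b c
      obtain ⟨a, rfl⟩ := QuotientGroup.mk'_surjective _ a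
      obtain ⟨b, rfl⟩ := QuotientGroup.mk'_surjective _ b
      obtain ⟨c, rfl⟩ := QuotientGroup.mk'_surjective _ c
      rw [← map_commutatorElement, ← map_commutatorElement, QuotientGroup.mk'_apply,
        QuotientGroup.eq_one_iff, Subgroup.mem_center_iff]
      exact fun t => Subtype.ext (Subgroup.mem_center_iff.1 (hM a b c) t))
    (fun i => QuotientGroup.mk' _ (y i)) (by
      intro i
      rw [← map_pow, QuotientGroup.mk'_apply, QuotientGroup.eq_one_iff]
      refine mem_center_of_closure_eq_top hy ?_
      rintro _ ⟨j, rfl⟩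
      exact Subtype.ext (hz i j))
  refine ⟨φ, ?_, hφ⟩
  rw [← MonoidHom.range_eq_top, eq_top_iff]
  rintro q -
  obtain ⟨t, rfl⟩ := QuotientGroup.mk'_surjective _ q
  have ht : t ∈ Subgroup.closure (Set.range y) := hy ▸ Subgroup.mem_top t
  induction ht using Subgroup.closure_induction with
  | mem _ h => obtain ⟨i, rfl⟩ := h; exact ⟨_, hφ i⟩
  | one => simp
  | mul a b _ _ ha hb => rw [map_mul]; exact mul_mem ha hb
  | inv a _ ha => rw [map_inv]; exact inv_mem ha

/-- The image of `g` under every homomorphism onto a quotient `T / Z(T)` is trivial.  Groups `T` in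
the lowest universe are enough to detect elements of the 2-nilpotent product. -/
def IsUndetectable {G : Type*} [Group G] (g : G) : Prop :=
  ∀ (T : Type) [Group T] (φ : G →* T ⧸ Subgroup.center T), Function.Surjective φ → φ g = 1

section Detection

open UnitriangularFour

variable {ι : Type*} [LinearOrder ι] {C : ι → Type*} [∀ i, Group (C i)] {x : ∀ i, C i}

/-- Two group elements placed at the indices `i` and `j`, and the identity elsewhere. -/
def pairFamily {M : Type*} [One M] (i j : ι) (u v : M) (l : ι) : M :=
  if l = i then u else if l = j then v else 1

theorem pairFamily_left {M : Type*} [One M] (i j : ι) (u v : M) : pairFamily i j u v i = u := by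
  simp [pairFamily]

theorem pairFamily_right {M : Type*} [One M] {i j : ι} (hij : i ≠ j) (u v : M) :
    pairFamily i j u v j = v := by
  simp [pairFamily, hij.symm]

theorem commute_pairFamily_pow {M : Type*} [Group M] {i j : ι} {u v : M} {k : ι → ℕ}
    (hu : Commute (u ^ k i) v) (hv : Commute (v ^ k j) u) (l m : ι) :
    Commute (pairFamily i j u v l ^ k l) (pairFamily i j u v m) := by
  have hu' : Commute (u ^ k i) u := Commute.pow_self _ _
  have hv' : Commute (v ^ k j) v := Commute.pow_self _ _
  unfold pairFamily
  split_ifs <;> subst_vars <;> simp_all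

theorem commute_pairFamily {M : Type*} [Group M] {i j : ι} (u v : M) (hij : i < j)
    {p : {p : ι × ι // p.1 < p.2}} (hp : p ≠ ⟨(i, j), hij⟩) :
    Commute (pairFamily i j u v p.1.1) (pairFamily i j u v p.1.2) := by
  obtain ⟨⟨a, b⟩, hab⟩ := p
  replace hab : a < b := hab
  simp only [ne_eq, Subtype.mk.injEq, Prod.mk.injEq, not_and] at hp
  unfold pairFamily
  split_ifs <;> subst_vars <;> simp_all
  exact (lt_asymm hab hij).elim

/-- The homomorphism attached to the matrices `skewRotation` and `rotation`, placed at a pair of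
indices at which the orders are divisible by `n`. -/
theorem exists_hom_skewRotation_rotation (hx : ∀ i, Subgroup.zpowers (x i) = ⊤) {i j : ι} {n : ℕ}
    (hn : Even n) (hi : n ∣ orderOf (x i)) (hj : n ∣ orderOf (x j))
    {z : ι → UnitriangularFour (ZMod (2 * n))}
    (hz : z = pairFamily i j (skewRotation (ZMod (2 * n))) (rotation (ZMod (2 * n)))) :
    ∃ φ : NilpotentProduct 2 C →* Subgroup.closure (Set.range z) ⧸
        Subgroup.center (Subgroup.closure (Set.range z)),
      Function.Surjective φ ∧ ∀ l, φ (NilpotentProduct.of 2 l (x l)) =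
        QuotientGroup.mk' _ ⟨z l, Subgroup.subset_closure ⟨l, rfl⟩⟩ := by
  subst hz
  refine NilpotentProduct.exists_hom_quotient_center hx commutator_commutator_mem_center _
    (commute_pairFamily_pow (k := fun l => orderOf (x l)) ?_ ?_)
  · obtain ⟨q, hq⟩ := hi
    rw [hq, pow_mul]
    exact (commute_skewRotation_pow_rotation hn).pow_left q
  · obtain ⟨q, hq⟩ := hj
    rw [hq, pow_mul]
    exact (commute_rotation_pow_skewRotation hn).pow_left q

/-- The entry `c` descends to the central quotient, because central elements commute with the
rotation; it reads off twice the exponent of `x i`. -/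
theorem IsUndetectable.dvd_exponent [Fintype ι] (hx : ∀ i, Subgroup.zpowers (x i) = ⊤)
    {g : NilpotentProduct 2 C} (hg : IsUndetectable g) {e : ι → ℤ}
    (he : Abelianization.of g = ∏ l, Abelianization.of (NilpotentProduct.of 2 l (x l)) ^ e l)
    {i j : ι} (hij : i ≠ j) {n : ℕ} (hn : Even n) (hi : n ∣ orderOf (x i))
    (hj : n ∣ orderOf (x j)) : (n : ℤ) ∣ e i := by
  obtain ⟨z, hz⟩ : ∃ z, z = pairFamily i j (skewRotation (ZMod (2 * n))) (rotation _) := ⟨_, rfl⟩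
  obtain ⟨φ, hsurj, hφ⟩ := exists_hom_skewRotation_rotation hx hn hi hj hz
  let T := Subgroup.closure (Set.range z)
  let χ : T ⧸ Subgroup.center T →* Multiplicative (ZMod (2 * n)) :=
    QuotientGroup.lift _ ((cHom (ZMod (2 * n))).comp T.subtype) fun t ht => by
      have h := Subgroup.mem_center_iff.1 ht ⟨z j, Subgroup.subset_closure ⟨j, rfl⟩⟩
      have h' : Commute (t : UnitriangularFour (ZMod (2 * n))) (z j) :=
        (congrArg Subtype.val h).symm
      rw [hz, pairFamily_right hij] at h'
      have hc := c_eq_zero_of_commute_rotation h'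
      exact congrArg Multiplicative.ofAdd hc
  have hχ : ∀ l, χ (φ (NilpotentProduct.of 2 l (x l))) = Multiplicative.ofAdd (z l).c := fun l => by
    rw [hφ l]; rfl
  have h := congrArg (Abelianization.lift (χ.comp φ)) he
  rw [Abelianization.lift_apply_of, MonoidHom.comp_apply, hg _ φ hsurj, map_one, map_prod] at h
  simp only [map_zpow, Abelianization.lift_apply_of, MonoidHom.comp_apply, hχ] at h
  rw [Finset.prod_eq_single i] at h
  · rw [hz, pairFamily_left, ← ofAdd_zsmul] at h
    have h' := congrArg Multiplicative.toAdd h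
    apply dvd_of_intCast_mul_two_eq_zero
    simpa [skewRotation, eq_comm] using h'
  · intro l _ hl
    have : (z l).c = 0 := by
      rw [hz]; unfold pairFamily
      rw [if_neg hl]
      split_ifs <;> rfl
    rw [this, ofAdd_zero, one_zpow]
  · simp

/-- All factors of the image of `g` but one vanish: the power of `x l` because `n`-th powers of the
matrices are central, the other commutators because one of their entries is trivial.  What remains is
a power of the commutator of the two matrices, which is central only if `n` divides the exponent. -/
theorem IsUndetectable.dvd_exponent_centralCommutator [Fintype ι]
    (hG : ∀ a b c : NilpotentProduct 2 C, ⁅⁅a, b⁆, c⁆ = 1)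
    (hx : ∀ i, Subgroup.zpowers (x i) = ⊤) {g : NilpotentProduct 2 C} (hg : IsUndetectable g)
    {f : {p : ι × ι // p.1 < p.2} → ℤ} {l : ι} {m : ℤ}
    (hf : g = ((∏ p, centralCommutator hG (fun l => NilpotentProduct.of 2 l (x l)) p ^ f p :
      Subgroup.center (NilpotentProduct 2 C)) : NilpotentProduct 2 C) *
        NilpotentProduct.of 2 l (x l) ^ m)
    (p : {p : ι × ι // p.1 < p.2}) {n : ℕ} (hn : Even n) (hi : n ∣ orderOf (x p.1.1))
    (hj : n ∣ orderOf (x p.1.2)) (hm : (n : ℤ) ∣ m) : (n : ℤ) ∣ f p := by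
  classical
  obtain ⟨⟨i, j⟩, hij⟩ := p
  have hij' : i < j := hij
  obtain ⟨z, hz⟩ : ∃ z, z = pairFamily i j (skewRotation (ZMod (2 * n))) (rotation _) := ⟨_, rfl⟩
  obtain ⟨φ, hsurj, hφ⟩ := exists_hom_skewRotation_rotation hx hn hi hj hz
  let t : ι → Subgroup.closure (Set.range z) := fun l => ⟨z l, Subgroup.subset_closure ⟨l, rfl⟩⟩
  have hφ' : ∀ l, φ (NilpotentProduct.of 2 l (x l)) = QuotientGroup.mk' _ (t l) := hφ
  have hpow : φ (NilpotentProduct.of 2 l (x l) ^ m) = 1 := by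
    obtain ⟨q, rfl⟩ := hm
    rw [zpow_mul, zpow_natCast, map_zpow, map_pow, hφ', ← map_pow]
    convert one_zpow q
    rw [QuotientGroup.mk'_apply, QuotientGroup.eq_one_iff, Subgroup.mem_center_iff]
    intro s
    have hs : (s : UnitriangularFour (ZMod (2 * n))) ∈ Subgroup.centralizer {z l ^ n} := by
      refine (Subgroup.closure_le _).2 ?_ s.2
      rintro _ ⟨k, rfl⟩
      rw [SetLike.mem_coe, Subgroup.mem_centralizer_singleton_iff]
      rw [hz]
      exact (commute_pairFamily_pow (k := fun _ => n) (commute_skewRotation_pow_rotation hn)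
        (commute_rotation_pow_skewRotation hn) l k).symm
    exact Subtype.ext (Subgroup.mem_centralizer_singleton_iff.1 hs)
  have h1 := hg _ φ hsurj
  rw [hf, map_mul, hpow, mul_one] at h1
  let c := centralCommutator hG (fun l => NilpotentProduct.of 2 l (x l))
  have hc : ∀ p, φ (c p) = QuotientGroup.mk' _ ⁅t p.1.1, t p.1.2⁆ := fun p => by
    rw [map_commutatorElement, ← hφ', ← hφ', ← map_commutatorElement]; rfl
  let ψ := φ.comp (Subgroup.center (NilpotentProduct 2 C)).subtype
  have h2 : ψ (c ⟨(i, j), hij⟩ ^ f ⟨(i, j), hij⟩) = 1 := by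
    have h3 : ψ (∏ p ∈ Finset.univ.erase ⟨(i, j), hij⟩, c p ^ f p) = 1 := by
      refine Subgroup.prod_mem ψ.ker fun p hp => ?_
      refine Subgroup.zpow_mem _ ?_ _
      change φ (c p) = 1
      have ht : ⁅t p.1.1, t p.1.2⁆ = 1 := by
        rw [commutatorElement_eq_one_iff_commute]
        refine Subtype.ext ?_
        change z _ * z _ = z _ * z _
        rw [hz]
        exact (commute_pairFamily _ _ hij' (Finset.ne_of_mem_erase hp)).eq
      rw [hc, ht, map_one]
    have h4 := Finset.mul_prod_erase Finset.univ (fun p => c p ^ f p)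
      (Finset.mem_univ ⟨(i, j), hij⟩)
    have h5 : ψ (∏ p, c p ^ f p) = 1 := h1
    rw [← h4, map_mul, h3, mul_one] at h5
    exact h5
  rw [map_zpow] at h2
  have h6 : QuotientGroup.mk' (Subgroup.center _) (⁅t i, t j⁆ ^ f ⟨(i, j), hij⟩) = 1 := by
    rw [map_zpow, ← hc ⟨(i, j), hij⟩]; exact h2
  rw [QuotientGroup.mk'_apply, QuotientGroup.eq_one_iff, Subgroup.mem_center_iff] at h6
  have h7 := congrArg Subtype.val (h6 (t j))
  apply dvd_of_commute_commutator_zpow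
  have h8 : Commute (⁅z i, z j⁆ ^ f ⟨(i, j), hij⟩) (z j) := h7.symm
  rwa [hz, pairFamily_left, pairFamily_right hij'.ne] at h8

/-- For orders `2 * n` and `n`, the group generated by the translation and the rotation detects
the powers of the generator of order `2 * n`. -/
theorem IsUndetectable.dvd_exponent_of_eq_zpow (hx : ∀ i, Subgroup.zpowers (x i) = ⊤)
    {i j : ι} (hij : i ≠ j) {m : ℤ}
    (hg : IsUndetectable (NilpotentProduct.of (C := C) 2 i (x i) ^ m)) {n : ℕ} (hn : Even n)
    (hi : orderOf (x i) = 2 * n) (hj : orderOf (x j) = n) : ((2 * n : ℕ) : ℤ) ∣ m := by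
  set z := pairFamily i j (translation (ZMod (2 * n))) (rotation (ZMod (2 * n))) with hz
  obtain ⟨φ, hsurj, hφ⟩ := NilpotentProduct.exists_hom_quotient_center hx
    commutator_commutator_mem_center z
    (commute_pairFamily_pow (k := fun l => orderOf (x l))
      (by rw [hi]; exact commute_translation_pow_rotation)
      (by rw [hj]; exact commute_rotation_pow_translation hn))
  have h1 := hg _ φ hsurj
  rw [map_zpow, hφ, ← map_zpow, QuotientGroup.mk'_apply, QuotientGroup.eq_one_iff,
    Subgroup.mem_center_iff] at h1
  have h2 := congrArg Subtype.val (h1 ⟨z j, Subgroup.subset_closure ⟨j, rfl⟩⟩)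
  have h3 : Commute (z i ^ m) (z j) := h2.symm
  rw [hz, pairFamily_left, pairFamily_right hij] at h3
  exact dvd_of_commute_translation_zpow h3

end Detection

/-! ### The criterion -/

/-- The exponents of an undetectable element vanish: those of the generators other than `x l`, then
those of the commutators, and last the exponent of `x l`.  Here `l` is the largest index and `m` the
largest of the others. -/
theorem IsUndetectable.eq_one {r : ℕ} {C : Fin r → Type*} [∀ i, Group (C i)] {x : ∀ i, C i}
    (hx : ∀ i, Subgroup.zpowers (x i) = ⊤) {α : Fin r → ℕ} (hord : ∀ i, orderOf (x i) = 2 ^ α i)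
    (hα_pos : ∀ i, 1 ≤ α i) (hα_mono : Monotone α) {l m : Fin r} (hml : m ≠ l)
    (hl : ∀ i, i ≤ l) (hm : ∀ i, i ≠ l → i ≤ m) (hα : α l ≤ α m + 1)
    {g : NilpotentProduct 2 C} (hg : IsUndetectable g) : g = 1 := by
  have hG := commutatorElement_commutatorElement_eq_one_of_lowerCentralSeries
    (NilpotentProduct.lowerCentralSeries_eq_bot (C := C) 2)
  have hcl := NilpotentProduct.closure_range_of_gen 2 hx
  have heven : ∀ i, Even (2 ^ α i) := fun i =>
    even_two.pow_of_ne_zero (Nat.one_le_iff_ne_zero.1 (hα_pos i))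
  have hdvd : ∀ i j, i ≤ j → 2 ^ α i ∣ orderOf (x j) := fun i j hij => by
    rw [hord]; exact pow_dvd_pow 2 (hα_mono hij)
  have hpow : ∀ i, NilpotentProduct.of 2 i (x i) ^ 2 ^ α i = 1 := fun i => by
    rw [← map_pow, ← hord, pow_orderOf_eq_one, map_one]
  have hzpow : ∀ i (k : ℤ), ((2 ^ α i : ℕ) : ℤ) ∣ k → NilpotentProduct.of 2 i (x i) ^ k = 1 := by
    rintro i _ ⟨q, rfl⟩
    rw [zpow_mul, zpow_natCast, hpow, one_zpow]
  obtain ⟨e, he⟩ := exists_abelianization_of_eq_prod hcl g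
  have he_ne : ∀ i, i ≠ l → NilpotentProduct.of 2 i (x i) ^ e i = 1 := fun i hi =>
    hzpow i _ (hg.dvd_exponent hx he hi (heven i) (hdvd i i le_rfl) (hdvd i l (hl i)))
  have he_l : ((2 ^ α m : ℕ) : ℤ) ∣ e l :=
    hg.dvd_exponent hx he hml.symm (heven m) (hdvd m l (hl m)) (hdvd m m le_rfl)
  have hab : Abelianization.of (g * (NilpotentProduct.of 2 l (x l) ^ e l)⁻¹) = 1 := by
    rw [map_mul, map_inv, he, Finset.prod_eq_single l, map_zpow, mul_inv_cancel]
    · intro i _ hi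
      rw [← map_zpow, he_ne i hi, map_one]
    · simp
  have hcomm : g * (NilpotentProduct.of 2 l (x l) ^ e l)⁻¹ ∈ commutator (NilpotentProduct 2 C) := by
    rwa [← Abelianization.ker_of, MonoidHom.mem_ker]
  obtain ⟨f, hf⟩ := exists_eq_prod_centralCommutator hG hcl hcomm
  rw [mul_inv_eq_iff_eq_mul] at hf
  have hf1 : ∀ p, centralCommutator hG (fun i => NilpotentProduct.of 2 i (x i)) p ^ f p = 1 := by
    intro p
    have hp : p.1.1 ≠ l := (p.2.trans_le (hl _)).ne
    obtain ⟨q, hq⟩ : ((2 ^ α p.1.1 : ℕ) : ℤ) ∣ f p :=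
      hg.dvd_exponent_centralCommutator hG hx hf p (heven _) (hdvd _ _ le_rfl) (hdvd _ _ p.2.le)
        ((Int.natCast_dvd_natCast.2 (pow_dvd_pow 2 (hα_mono (hm _ hp)))).trans he_l)
    have h1 : centralCommutator hG (fun i => NilpotentProduct.of 2 i (x i)) p ^ 2 ^ α p.1.1 = 1 :=
      Subtype.ext (commutatorElement_pow_eq_one hG (hpow p.1.1))
    rw [hq, zpow_mul, zpow_natCast, h1, one_zpow]
  have hgl : g = NilpotentProduct.of 2 l (x l) ^ e l := by
    rw [hf, Finset.prod_eq_one fun p _ => hf1 p]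
    simp
  rw [hgl]
  apply hzpow
  rcases (hα_mono (hl m)).eq_or_lt with h | h
  · rwa [← h]
  · have hlm : α l = α m + 1 := le_antisymm hα h
    have hl2 : 2 ^ α l = 2 * 2 ^ α m := by rw [hlm, pow_succ']
    rw [hl2]
    rw [hgl] at hg
    exact hg.dvd_exponent_of_eq_zpow hx hml.symm (heven m) ((hord l).trans hl2) (hord m)

theorem theorem5p2 (r : ℕ) (hr : 1 ≤ r)
    (C : Fin r → Type*) [∀ i, Group (C i)]
    (x : ∀ i, C i) (hx : ∀ i, Subgroup.zpowers (x i) = ⊤)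
    (α : Fin r → ℕ) (hord : ∀ i, orderOf (x i) = 2 ^ α i)
    (hα_pos : ∀ i, 1 ≤ α i) (hα_mono : Monotone α) :
    IsCapable (NilpotentProduct 2 C) ↔
      ∃ h : 1 < r, α ⟨r - 1, by omega⟩ ≤ α ⟨r - 2, by omega⟩ + 1 := by
  have hcl := NilpotentProduct.closure_range_of_gen 2 hx
  constructor
  · intro hcap
    have h : 1 < r := by
      by_contra h
      obtain rfl : r = 1 := by omega
      have h1 := hcap.eq_one_of_subsingleton hcl 0
      rw [← orderOf_eq_one_iff, NilpotentProduct.orderOf_of hx, hord] at h1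
      exact (Nat.one_lt_two_pow (Nat.one_le_iff_ne_zero.1 (hα_pos 0))).ne' h1
    refine ⟨h, ?_⟩
    have h2 := hcap.pow_two_mul_eq_one
      (commutatorElement_commutatorElement_eq_one_of_lowerCentralSeries
        (NilpotentProduct.lowerCentralSeries_eq_bot 2)) hcl
      (l := ⟨r - 1, by omega⟩) (n := 2 ^ α ⟨r - 2, by omega⟩) fun i hi => by
        have hi' : (i : ℕ) ≠ r - 1 := fun h => hi (Fin.ext h)
        have hle : i ≤ ⟨r - 2, by omega⟩ := Fin.le_def.2 (by have := i.2; dsimp only; omega)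
        apply orderOf_dvd_iff_pow_eq_one.1
        rw [NilpotentProduct.orderOf_of hx, hord]
        exact pow_dvd_pow 2 (hα_mono hle)
    rw [← orderOf_dvd_iff_pow_eq_one, NilpotentProduct.orderOf_of hx, hord, ← pow_succ'] at h2
    exact (Nat.pow_dvd_pow_iff_le_right one_lt_two).1 h2
  · rintro ⟨h, hα⟩
    refine isCapable_of_forall_ne_one fun g hg => ?_
    by_contra hcon
    refine hg (IsUndetectable.eq_one hx hord hα_pos hα_mono (l := ⟨r - 1, by omega⟩)
      (m := ⟨r - 2, by omega⟩) ?_ ?_ ?_ hα fun T _ φ hφ => ?_)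
    · exact Fin.ne_of_val_ne (by dsimp only; omega)
    · exact fun i => Fin.le_def.2 (by have := i.2; dsimp only; omega)
    · intro i hi
      have hi' : (i : ℕ) ≠ r - 1 := fun h => hi (Fin.ext h)
      exact Fin.le_def.2 (by have := i.2; dsimp only; omega)
    · by_contra hne
      exact hcon ⟨T, inferInstance, φ, hφ, hne⟩
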